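/- Notation. Let $|{+_\theta}\rangle=\frac1{\sqrt2}(|0\rangle+e^{i\theta}|1\rangle)$ and $Z(\theta)=\mathrm{diag}(1,e^{i\theta})$, let $X,Z$ be the Pauli matrices, and let $\oplus$ be addition modulo 2. Let $\mathcal G=(V,E)$ be a finite simple graph with input set $I\subseteq V$ and output set $O\subseteq V$ (which may intersect), and let $N_{\mathcal G}(v)$ be the set of neighbours of $v$. Let $(f,\succ)$ be a flow of $(\mathcal G,I,O)$: a map $f:O^c\to I^c$ and a strict partial order $\succ$ on $V$ such that, for all $j\in O^c$, $(j,f(j))\in E$, $f(j)\succ j$, and $k\succ j$ for all $k\in N_{\mathcal G}(f(j))\setminus\{j\}$. Let $V=V_{\mathcal A}\sqcup V_{\mathcal O}$ be the nodes of Alice and of Oscar, with $I,O\subseteq V_{\mathcal A}$. Let $\Omega=\{\pi k/2^{b-1}:0\le k<2^b\}$. Alice holds angles $\phi_i\in\Omega$ $(i\in V_{\mathcal A}\setminus O)$ and a state $\rho$ of the qubits in $I$; Oscar holds angles $\psi_i\in\Omega$ $(i\in V_{\mathcal O})$; let $\theta=\phi\cup\psi$. Let $E_{\mathcal G}$ be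 the product of the CPHASE gates over the edges of $\mathcal G$, and let $N^0_{I^c}$ prepare $|{+_0}\rangle$ on each qubit of $I^c$. For bits $s=(s_k)_{k\in O^c}$ and $t=(t_k)_{k\in I}$ put $$z(i)=\bigoplus_{k\prec i,\ i\in N_{\mathcal G}(f(k))}s_k,\qquad t(i)=\bigoplus_{k\in I,\ i\in N_{\mathcal G}(k)}t_k,$$ with $s_{f^{-1}(i)}=0$ if $i$ is not in the range of $f$, and $t_i=0$ if $i\notin I$. The BOQC protocol with an honest server (Bob). (0) Alice and Oscar share uniformly random key bits $r_i$ $(i\in O^c)$ and $t_j$ $(j\in I)$. Alice privately chooses uniform $\alpha_i\in\Omega$ for $i\in V_{\mathcal A}\setminus O$, and Oscar privately chooses uniform $\beta_i\in\Omega$ for $i\in V_{\mathcal O}$. All choices are independent. (1) Alice applies $Z(\alpha_i)X^{t_i}$ to each input qubit $i\in I\setminus O$ and $X^{t_i}$ to each $i\in I\cap O$, and sends the qubits to Bob. She sends $|{+_{\alpha_i}}\rangle$ for each $i\in V_{\mathcal A}\setminus(I\cup O)$, and Oscar sends $|{+_{\beta_i}}\rangle$ for each $i\in V_{\mathcal O}$.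 Bob prepares $|{+_0}\rangle$ for each $i\in O\setminus I$. Alice replaces each $\phi_i$ by $(-1)^{t_i}\phi_i+t(i)\pi$, and Oscar replaces each $\psi_i$ by $\psi_i+t(i)\pi$. (2) Bob applies $E_{\mathcal G}$. (3) The nodes of $O^c$ are treated in a total order consistent with $\succ$. At node $i$ its owner (Alice, or Oscar) sends Bob $\delta_i=(-1)^{s_{f^{-1}(i)}}\phi_i+z(i)\pi+\pi r_i+\alpha_i$ (or the same expression with $\psi_i,\beta_i$). Bob measures qubit $i$ in the basis $|{+_{\delta_i}}\rangle$ (outcome $0$), $|{+_{\delta_i+\pi}}\rangle$ (outcome $1$) and reports the outcome $\tilde s_i$ to both clients, who set $s_i=\tilde s_i\oplus r_i$. (4) Bob sends the qubits in $O$ to Alice, who applies $\bigotimes_{i\in O}X_i^{s_{f^{-1}(i)}\oplus t_i}Z_i^{z(i)\oplus t(i)}$. Thus each client acts only on the public data, its own angles and random angles, the shared key and the reported outcomes (Alice also on $\rho$); the two clients do not communicate during the run. Theorem. For all such data and every total order of $O^c$ consistent with $\succ$, let $$W=2^{|O^c|/2}\,\Bigl(\bigotimes_{i\in O^c}\langle{+_{\theta_i}}|_i\Bigr)E_{\mathcal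 G}N^0_{I^c}.$$ Then $W$ is an isometry. For all fixed values of $r,t,\alpha,\beta$ and every sequence of outcomes $\tilde s\in\{0,1\}^{O^c}$, Alice's final unnormalized state in that branch is $2^{-|O^c|}\,W\rho W^\dagger$; that is, each branch has probability $2^{-|O^c|}$ and ends in the state $W\rho W^\dagger$. Consequently, the map from Alice's input to Alice's output is $\rho\mapsto W\rho W^\dagger$, both for every fixed choice of $r,t,\alpha,\beta$ and for the whole protocol with random $r,t,\alpha,\beta$. These identities hold for every operator $\rho$ on the qubits in $I$. -/

import Mathlib

open scoped Matrix BigOperators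

noncomputable section

namespace BOQC

/-! ### Qubit registers: a register of qubits labelled by `ι` has basis `ι → Fin 2`. -/

/-- Operators from the register labelled by `κ` to the register labelled by `ι`. -/
abbrev QMap (ι κ : Type*) : Type _ := Matrix (ι → Fin 2) (κ → Fin 2) ℂ

/-- Square operators on a register; density operators are particular elements. -/
abbrev QOp (ι : Type*) : Type _ := QMap ι ι

/-- The amplitudes of `|+_θ⟩ = (|0⟩ + e^{iθ}|1⟩)/√2`. -/
def ketPlus (θ : ℝ) : Fin 2 → ℂ :=
  ![((Real.sqrt 2 : ℝ) : ℂ)⁻¹, ((Real.sqrt 2 : ℝ) : ℂ)⁻¹ * Complex.exp (Complex.I * (θ : ℂ))]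

/-- The projector `|+_θ⟩⟨+_θ|`. -/
def projPlus (θ : ℝ) : Matrix (Fin 2) (Fin 2) ℂ :=
  Matrix.vecMulVec (ketPlus θ) (star (ketPlus θ))

/-- Pauli `X`. -/
def pauliX : Matrix (Fin 2) (Fin 2) ℂ := !![0, 1; 1, 0]

/-- The rotation `Z(θ) = diag(1, e^{iθ})`. -/
def rotZ (θ : ℝ) : Matrix (Fin 2) (Fin 2) ℂ := !![1, 0; 0, Complex.exp (Complex.I * (θ : ℂ))]

/-- Pauli `Z`. -/
def pauliZ : Matrix (Fin 2) (Fin 2) ℂ := !![1, 0; 0, -1]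

/-- The tensor product of one-qubit operators, one for each qubit of the register. -/
def tensorOp {ι : Type*} [Fintype ι] (U : ι → Matrix (Fin 2) (Fin 2) ℂ) : QOp ι :=
  fun x y => ∏ i, U i (x i) (y i)

/-- The one-qubit operator `U` acting on qubit `i`, identity on the other qubits. -/
def onQubit {ι : Type*} [Fintype ι] [DecidableEq ι] (i : ι) (U : Matrix (Fin 2) (Fin 2) ℂ) :
    QOp ι :=
  tensorOp (Function.update (fun _ => 1) i U)

/-- Adding fresh qubits: `|ξ⟩ ↦ |ξ⟩ ⊗ ⨂_{i ∉ S} |+_{γ i}⟩`, where `|ξ⟩` is a state of the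
qubits in `S`. Only the values of `γ` outside `S` matter. This is `N_{Sᶜ}^γ`; its adjoint
is `⨂_{i ∉ S} ⟨+_{γ i}|`. -/
def prep {V : Type*} [Fintype V] [DecidableEq V] (S : Finset V) (γ : V → ℝ) : QMap V S :=
  fun x y =>
    if (fun i : S => x i) = y then ∏ i : {v // v ∉ S}, ketPlus (γ i) (x i) else 0

open scoped Classical in
/-- The entangling operator `E_G`: the product over the edges `{i,j}` of CPHASE on `i, j`.
CPHASE is diagonal and multiplies a basis vector by `-1` exactly if both its qubits are `1`. -/
def entangle {V : Type*} [Fintype V] (G : SimpleGraph V) : QOp V :=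
  Matrix.diagonal fun x =>
    ∏ e ∈ Finset.univ.filter (fun e : Sym2 V => e ∈ G.edgeSet),
      if ∀ v ∈ e, x v = 1 then (-1 : ℂ) else 1

/-- The partial trace that keeps the qubits in `O` and discards all others. -/
def traceOut {V : Type*} [Fintype V] [DecidableEq V] (O : Finset V) (ρ : QOp V) : QOp O :=
  fun a b => ∑ c : {v // v ∉ O} → Fin 2,
    ρ (fun v => if h : v ∈ O then a ⟨v, h⟩ else c ⟨v, h⟩)
      (fun v => if h : v ∈ O then b ⟨v, h⟩ else c ⟨v, h⟩)

/-- `ρ ↦ K ρ K†`. -/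
def conj {ι κ : Type*} [Fintype κ] [DecidableEq κ] (K : QMap ι κ) (ρ : QOp κ) : QOp ι := K * ρ * Kᴴ

/-- The allowed angles `Ω = {π k / 2^(b-1) : 0 ≤ k < 2^b}`. -/
def Omega (b : ℕ) : Finset ℝ :=
  (Finset.range (2 ^ b)).image fun k : ℕ => Real.pi * (k : ℝ) / (2 : ℝ) ^ ((b : ℤ) - 1)

/-! ### Open graphs with flow -/

/-- `(f, ≺)` is a flow of the open graph `(G, I, O)`, for a map `f : Oᶜ → Iᶜ` and a strict
partial order `≺` on the nodes. -/
structure IsFlow {V : Type*} (G : SimpleGraph V) (I O : Finset V)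
    (f : {v // v ∉ O} → {v // v ∉ I}) (prec : V → V → Prop) : Prop where
  strict : IsStrictOrder V prec
  adj : ∀ j : {v // v ∉ O}, G.Adj j (f j)
  lt : ∀ j : {v // v ∉ O}, prec j (f j)
  lt_neighbor : ∀ j : {v // v ∉ O}, ∀ k, G.Adj (f j) k → k ≠ j → prec j k

/-- What the parties have agreed on before the protocol starts: an open graph with flow, the
set `VA` of Alice's nodes (all other nodes belong to Oscar) and the bit size `b` of the
angles. Inputs and outputs belong to Alice. -/
structure Setup (V : Type*) where
  G : SimpleGraph V
  I : Finset V
  O : Finset V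
  f : {v // v ∉ O} → {v // v ∉ I}
  prec : V → V → Prop
  flow : IsFlow G I O f prec
  VA : Finset V
  input_subset : I ⊆ VA
  output_subset : O ⊆ VA
  b : ℕ

namespace Setup

variable {V : Type*} (P : Setup V)

/-- The nodes to be measured. -/
abbrev Measured : Type _ := {v // v ∉ P.O}

/-- The measured nodes of Alice. -/
abbrev AliceNode : Type _ := {i : P.Measured // i.1 ∈ P.VA}

/-- The measured nodes of Oscar (by `output_subset`, all of Oscar's nodes). -/
abbrev OscarNode : Type _ := {i : P.Measured // i.1 ∉ P.VA}

/-- A record of one bit for each measured node. -/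
abbrev Record : Type _ := P.Measured → ZMod 2

/-- A total order of the measured nodes, as a list, consistent with `≺`. -/
structure IsSchedule (l : List P.Measured) : Prop where
  nodup : l.Nodup
  complete : ∀ i, i ∈ l
  consistent : l.Pairwise fun i j => ¬ P.prec j i

variable [Fintype V] [DecidableEq V]

/-- All measurement angles `θ = φ ∪ ψ`; the value at the unmeasured nodes is never used. -/
def angles (φ : P.AliceNode → Omega P.b) (ψ : P.OscarNode → Omega P.b) (v : V) : ℝ :=
  if hO : v ∉ P.O then
    if hA : v ∈ P.VA then (φ ⟨⟨v, hO⟩, hA⟩ : ℝ) else (ψ ⟨⟨v, hO⟩, hA⟩ : ℝ)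
  else 0

/-- The operator `⨂_{i ∉ O} ⟨+_{θ i}| E_G N_{Iᶜ}^0`. -/
def patternMap (θ : V → ℝ) : QMap P.O P.I :=
  (prep P.O θ)ᴴ * entangle P.G * prep P.I (fun _ => 0)

/-- The same operator, normalized by `2^{|Oᶜ|/2}`: each of the `2^{|Oᶜ|}` equally likely runs
of the pattern realizes `patternMap` up to a phase. -/
def isometry (θ : V → ℝ) : QMap P.O P.I :=
  ((Real.sqrt 2 : ℝ) : ℂ) ^ Fintype.card P.Measured • P.patternMap θ

/-! ### Signals -/

/-- `s_{f⁻¹(i)}`, which is `0` if `i` is not in the range of `f`. As a flow map is injective,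
the sum has at most one term. -/
def xSignal (s : P.Record) (i : V) : ZMod 2 :=
  ∑ k : P.Measured, if (P.f k : V) = i then s k else 0

open scoped Classical in
/-- `z(i) = ⨁_{k ≺ i, i ∈ N(f k)} s_k`. -/
def zSignal (s : P.Record) (i : V) : ZMod 2 :=
  ∑ k : P.Measured, if P.prec k i ∧ P.G.Adj (P.f k) i then s k else 0

/-- `t_i`, extended by `0` to the nodes that are no inputs. -/
def xPad (t : P.I → ZMod 2) (i : V) : ZMod 2 :=
  if h : i ∈ P.I then t ⟨i, h⟩ else 0

open scoped Classical in
/-- `t(i) = ⨁_{k ∈ I, i ∈ N(k)} t_k`. -/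
def zPad (t : P.I → ZMod 2) (i : V) : ZMod 2 :=
  ∑ k : P.I, if P.G.Adj k i then t k else 0

/-- A client's angle for node `i` after the updates `θ_i := (-1)^{t_i} θ_i` (at inputs) and
`θ_i := θ_i + t_k π` (for each input `k` adjacent to `i`); angles matter modulo `2π` only. -/
def padAngle (t : P.I → ZMod 2) (i : V) (θ : ℝ) : ℝ :=
  (-1) ^ (P.xPad t i).val * θ + ((P.zPad t i).val : ℝ) * Real.pi

/-- The adapted angle `(-1)^{s_{f⁻¹(i)}} θ + z(i) π`. -/
def adaptAngle (s : P.Record) (i : V) (θ : ℝ) : ℝ :=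
  (-1) ^ (P.xSignal s i).val * θ + ((P.zSignal s i).val : ℝ) * Real.pi

/-! ### The two clients

Each client is a converter that sees only the agreed setup, its own secret angles, its own
random angles, the shared key `(r, t)` and the outcomes reported by Bob. -/

/-- What Alice does: the operator applied to her input qubits before she sends them; the angles
`α` of the qubits `|+_α⟩` sent for her measured nodes that are no inputs; the angles announced
to Bob, as a function of the outcomes reported so far; the final correction of the output. -/
structure AliceConverter where
  encrypt : QOp P.I
  prepare : P.AliceNode → ℝ
  announce : P.Record → P.AliceNode → ℝ
  correct : P.Record → QOp P.O

/-- What Oscar does: the angles `β` of the qubits `|+_β⟩` that he sends, and the angles announced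
to Bob, as a function of the outcomes reported so far. -/
structure OscarConverter where
  prepare : P.OscarNode → ℝ
  announce : P.Record → P.OscarNode → ℝ

/-- Alice in the protocol. She applies `Z(α_i) X^{t_i}` to an input qubit `i` that will be
measured, and `X^{t_i}` to an input qubit that is also an output. -/
def alice (r : P.Record) (t : P.I → ZMod 2)
    (φ α : P.AliceNode → Omega P.b) : P.AliceConverter where
  encrypt := tensorOp fun i =>
    if h : (i : V) ∉ P.O then
      rotZ (α ⟨⟨i, h⟩, P.input_subset i.2⟩ : ℝ) * pauliX ^ (t i).val
    else pauliX ^ (t i).val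
  prepare := fun i => α i
  announce := fun m i =>
    P.adaptAngle (m + r) i (P.padAngle t i (φ i)) + Real.pi * ((r i).val : ℝ) + α i
  correct := fun m => tensorOp fun i =>
    pauliX ^ (P.xSignal (m + r) i + P.xPad t i).val *
      pauliZ ^ (P.zSignal (m + r) i + P.zPad t i).val

/-- Oscar in the protocol. -/
def oscar (r : P.Record) (t : P.I → ZMod 2)
    (ψ β : P.OscarNode → Omega P.b) : P.OscarConverter where
  prepare := fun i => β i
  announce := fun m i =>
    P.adaptAngle (m + r) i (P.padAngle t i (ψ i)) + Real.pi * ((r i).val : ℝ) + β i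

/-! ### Execution with the honest server -/

/-- The angles in which the nodes outside `I` are prepared: by Alice and Oscar at their measured
nodes, and by Bob with angle `0` at the outputs. -/
def prepAngle (A : P.AliceConverter) (B : P.OscarConverter) (v : V) : ℝ :=
  if hO : v ∉ P.O then
    if hA : v ∈ P.VA then A.prepare ⟨⟨v, hO⟩, hA⟩ else B.prepare ⟨⟨v, hO⟩, hA⟩
  else 0

/-- The angle that Bob is told to measure node `i` in, after the outcomes recorded in `m`: the
owner of the node announces it. -/
def announced (A : P.AliceConverter) (B : P.OscarConverter) (m : P.Record) (i : P.Measured) :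
    ℝ :=
  if hA : i.1 ∈ P.VA then A.announce m ⟨i, hA⟩ else B.announce m ⟨i, hA⟩

/-- The measurement phase along a list of nodes, in the branch in which Bob finds the outcomes
`ω`. `m` records the outcomes reported so far (`0` at nodes not yet measured) and `σ` is the
unnormalized state of all qubits. Node `i` is measured with the projectors on `|+_δ⟩`
(outcome `0`) and `|+_{δ+π}⟩` (outcome `1`). -/
def measureAll (A : P.AliceConverter) (B : P.OscarConverter) (ω : P.Record) :
    List P.Measured → P.Record → QOp V → QOp V
  | [], _, σ => σ
  | i :: l, m, σ =>
      measureAll A B ω l (Function.update m i (ω i))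
        (conj (onQubit (i : V)
          (projPlus (P.announced A B m i + ((ω i).val : ℝ) * Real.pi))) σ)

/-- Alice's final unnormalized state in the branch with outcomes `ω`; its trace is the
probability of the branch if `ρ` is a density operator. Measured qubits are discarded and the
qubits in `O` are sent to Alice. -/
def execute (A : P.AliceConverter) (B : P.OscarConverter) (l : List P.Measured)
    (ω : P.Record) (ρ : QOp P.I) : QOp P.O :=
  conj (A.correct ω) (traceOut P.O (P.measureAll A B ω l 0
    (conj (entangle P.G) (conj (prep P.I (P.prepAngle A B)) (conj A.encrypt ρ)))))

/-- The map from Alice's input to Alice's output for fixed converters: all branches together. -/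
def executeAll (A : P.AliceConverter) (B : P.OscarConverter) (l : List P.Measured)
    (ρ : QOp P.I) : QOp P.O :=
  ∑ ω : P.Record, P.execute A B l ω ρ

/-- The protocol: the keys `r`, `t` and the angles `α`, `β` are independent and uniform. -/
def protocol (φ : P.AliceNode → Omega P.b) (ψ : P.OscarNode → Omega P.b)
    (l : List P.Measured) (ρ : QOp P.I) : QOp P.O :=
  (Fintype.card (P.Record × (P.I → ZMod 2) × (P.AliceNode → Omega P.b) ×
      (P.OscarNode → Omega P.b)) : ℂ)⁻¹ •
    ∑ k : P.Record × (P.I → ZMod 2) × (P.AliceNode → Omega P.b) × (P.OscarNode → Omega P.b),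
      P.executeAll (P.alice k.1 k.2.1 φ k.2.2.1) (P.oscar k.1 k.2.1 ψ k.2.2.2) l ρ

end Setup

end BOQC

end

/-! All byproducts of a branch are handled at once. Let s = ω + r be the decrypted outcomes and x
the bit string `xSignal s + xPad t` on V. Before entangling, X^x costs nothing: off I it acts on
|+_0⟩, which X fixes, and on I it equals X^t, Alice's encryption, because f avoids I. The sign in
E_G is (-1)^q for the quadratic form q(x) = Σ x_u x_v over the edges, so polarization gives E_G X^x
= ± X^x Z^{Nx} E_G, where Nx sums x over neighbours (`entangle_mul_pauliX`). The flow conditions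
yield (Nx)_v = z(v) + t(v) + s_v at a measured v, and the same without s_v at an output
(`neighborSum_xByproduct`). At a measured node, this Pauli followed by Z(α) carries |+_θ⟩, up to a
phase, to the vector that Bob found: this is what the adapted, padded and encrypted angle is made
for (`exp_adapted_angle`). At an output it is the Pauli that Alice corrects. Hence every branch has
the same Kraus operator `patternMap` up to a phase (`kraus_eq_smul_patternMap`), and phases
disappear under `conj`. The measurement order matters only for merging the projectors
(`measureAll_eq_conj`). That W is an isometry is not read off the graph. Every step of a run
preserves the total trace (`trace_executeAll`), and the branches sum to ρ ↦ WρW†, so tr(W†Wρ) = tr ρ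
for all ρ. -/

namespace BOQC

/-! ### Registers split along a set of qubits -/

section Registers

variable {V : Type*} [DecidableEq V]

/-- The basis label that is `a` on `S` and `c` outside. -/
def glue (S : Finset V) (a : S → Fin 2) (c : {v // v ∉ S} → Fin 2) (v : V) : Fin 2 :=
  if h : v ∈ S then a ⟨v, h⟩ else c ⟨v, h⟩

@[simp] theorem glue_mem (S : Finset V) (a : S → Fin 2) (c : {v // v ∉ S} → Fin 2) (i : S) :
    glue S a c i = a i := by
  simp [glue]

@[simp] theorem glue_not_mem (S : Finset V) (a : S → Fin 2) (c : {v // v ∉ S} → Fin 2)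
    (i : {v // v ∉ S}) : glue S a c i = c i := by
  simp [glue, i.2]

variable {ι : Type*} [Fintype V]

theorem sum_glue {M : Type*} [AddCommMonoid M] (S : Finset V) (F : (V → Fin 2) → M) :
    ∑ x, F x = ∑ a : S → Fin 2, ∑ c : {v // v ∉ S} → Fin 2, F (glue S a c) := by
  rw [← Fintype.sum_prod_type']
  refine Fintype.sum_equiv
    (Equiv.mk (fun x => (fun i : S => x i, fun i : {v // v ∉ S} => x i))
      (fun p => glue S p.1 p.2) ?_ ?_) _ _ ?_
  · intro x
    funext v
    by_cases h : v ∈ S <;> simp [glue, h]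
  · rintro ⟨a, c⟩
    ext i <;> simp
  · intro x
    congr 1
    funext v
    by_cases h : v ∈ S <;> simp [glue, h]

theorem prod_split (S : Finset V) (g : V → ℂ) :
    ∏ v, g v = (∏ i : S, g i) * ∏ i : {v // v ∉ S}, g i :=
  (Fintype.prod_subtype_mul_prod_subtype (fun v => v ∈ S) g).symm.trans
    (by congr!)

theorem conj_conj {κ μ : Type*} [Fintype κ] [DecidableEq κ] [Fintype μ] [DecidableEq μ]
    (K : QMap ι κ) (L : QMap κ μ) (ρ : QOp μ) : conj K (conj L ρ) = conj (K * L) ρ := by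
  simp [conj, Matrix.mul_assoc, Matrix.conjTranspose_mul]

theorem conj_smul {κ : Type*} [Fintype κ] [DecidableEq κ] (c : ℂ) (K : QMap ι κ) (ρ : QOp κ) :
    conj (c • K) ρ = (c * star c) • conj K ρ := by
  simp [conj, smul_smul, mul_comm]

variable [Fintype ι]

theorem tensorOp_mul (D D' : ι → Matrix (Fin 2) (Fin 2) ℂ) [DecidableEq ι] :
    tensorOp D * tensorOp D' = tensorOp fun i => D i * D' i := by
  ext x y
  simp only [Matrix.mul_apply, tensorOp, ← Finset.prod_mul_distrib]
  rw [Finset.prod_univ_sum]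
  simp [Fintype.piFinset_univ]

theorem tensorOp_one [DecidableEq ι] :
    tensorOp (fun _ : ι => (1 : Matrix (Fin 2) (Fin 2) ℂ)) = 1 := by
  ext x y
  by_cases h : x = y
  · subst h; simp [tensorOp]
  · obtain ⟨i, hi⟩ := Function.ne_iff.1 h
    rw [Matrix.one_apply_ne h]
    exact Finset.prod_eq_zero (Finset.mem_univ i) (Matrix.one_apply_ne hi)

theorem tensorOp_conjTranspose (D : ι → Matrix (Fin 2) (Fin 2) ℂ) :
    (tensorOp D)ᴴ = tensorOp fun i => (D i)ᴴ := by
  ext x y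
  simp [tensorOp, Matrix.conjTranspose_apply]

theorem tensorOp_smul (c : ι → ℂ) (D : ι → Matrix (Fin 2) (Fin 2) ℂ) :
    tensorOp (fun i => c i • D i) = (∏ i, c i) • tensorOp D := by
  ext x y
  simp [tensorOp, Finset.prod_mul_distrib]

theorem tensorOp_unitary [DecidableEq ι] {D : ι → Matrix (Fin 2) (Fin 2) ℂ}
    (h : ∀ i, (D i)ᴴ * D i = 1) : (tensorOp D)ᴴ * tensorOp D = 1 := by
  simp [tensorOp_conjTranspose, tensorOp_mul, h, tensorOp_one]

/-- Adding fresh qubits outside `S`, in arbitrary one-qubit states `k`. -/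
def prepKets (S : Finset V) (k : V → Fin 2 → ℂ) : QMap V S :=
  fun x y => if (fun i : S => x i) = y then ∏ i : {v // v ∉ S}, k i (x i) else 0

theorem prep_eq_prepKets (S : Finset V) (γ : V → ℝ) :
    prep S γ = prepKets S fun v => ketPlus (γ v) := rfl

theorem prepKets_congr {S : Finset V} {k k' : V → Fin 2 → ℂ} (h : ∀ v, v ∉ S → k v = k' v) :
    prepKets S k = prepKets S k' := by
  ext x y
  unfold prepKets
  congr 1
  exact Finset.prod_congr rfl fun i _ => by rw [h i i.2]

theorem prepKets_smul (S : Finset V) (c : V → ℂ) (k : V → Fin 2 → ℂ) :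
    prepKets S (fun v => c v • k v) = (∏ i : {v // v ∉ S}, c i) • prepKets S k := by
  ext x y
  simp [prepKets, Finset.prod_mul_distrib]

/-- A product operator acts on the fresh kets and on the old register separately: the intermediate
sum over labels outside S factors over the qubits. -/
theorem tensorOp_mul_prepKets (S : Finset V) (D : V → Matrix (Fin 2) (Fin 2) ℂ)
    (k : V → Fin 2 → ℂ) :
    tensorOp D * prepKets S k =
      prepKets S (fun v => D v *ᵥ k v) * tensorOp fun i : S => D i := by
  ext x y
  rw [Matrix.mul_apply, Matrix.mul_apply, sum_glue S]
  simp only [prepKets, glue_mem, glue_not_mem, mul_ite, mul_zero, ite_mul, zero_mul,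
    Finset.sum_ite_eq, Finset.mem_univ, if_true]
  rw [Finset.sum_eq_single y (by intro b _ hb; simp [hb]) (by simp)]
  simp only [if_true, tensorOp]
  simp only [prod_split S (fun v => D v (x v) (glue S y _ v)), glue_mem, glue_not_mem,
    mul_assoc, ← Finset.mul_sum, ← Finset.prod_mul_distrib]
  rw [mul_comm]
  congr 1
  simp only [Matrix.mulVec, dotProduct]
  rw [Finset.prod_univ_sum]
  simp [Fintype.piFinset_univ]

theorem prepKets_conjTranspose_mul (S : Finset V) (k k' : V → Fin 2 → ℂ) :
    (prepKets S k)ᴴ * prepKets S k' = (∏ i : {v // v ∉ S}, star (k i) ⬝ᵥ k' i) • 1 := by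
  ext a b
  rw [Matrix.mul_apply, sum_glue S]
  simp only [prepKets, Matrix.conjTranspose_apply, glue_mem, glue_not_mem, Matrix.smul_apply]
  rw [Finset.sum_eq_single b (by intro d _ hd; simp [hd]) (by simp)]
  by_cases h : a = b
  · subst h
    simp only [if_true, star_prod, ← Finset.prod_mul_distrib, Matrix.one_apply_eq, smul_eq_mul,
      mul_one, dotProduct]
    rw [Finset.prod_univ_sum]
    simp [Fintype.piFinset_univ]
  · simp [h, Ne.symm h]

theorem trace_conj {κ : Type*} [Fintype κ] [DecidableEq κ] [DecidableEq ι] {K : QMap ι κ}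
    (ρ : QOp κ) : (conj K ρ).trace = (Kᴴ * K * ρ).trace := by
  rw [conj, Matrix.trace_mul_comm, Matrix.mul_assoc]

theorem trace_conj_of_isometry {κ : Type*} [Fintype κ] [DecidableEq κ] [DecidableEq ι]
    {K : QMap ι κ} (h : Kᴴ * K = 1) (ρ : QOp κ) : (conj K ρ).trace = ρ.trace := by
  rw [trace_conj, h, one_mul]

theorem trace_traceOut (O : Finset V) (τ : QOp V) : (traceOut O τ).trace = τ.trace := by
  simp only [Matrix.trace, Matrix.diag, traceOut]
  rw [sum_glue O]
  rfl

/-- Kraus form of the partial trace, with the basis bras ⟨c| off O; it lets `conj_conj` merge the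
discarding with the preceding projectors. The ket `0` on O is a dummy, since `prepKets` reads kets
only off its set. -/
theorem traceOut_eq_sum (O : Finset V) (τ : QOp V) :
    traceOut O τ = ∑ c : {v // v ∉ O} → Fin 2,
      conj (prepKets O fun v => if h : v ∉ O then Pi.single (c ⟨v, h⟩) 1 else 0)ᴴ τ := by
  have key : ∀ (c : {v // v ∉ O} → Fin 2) x a,
      prepKets O (fun v => if h : v ∉ O then Pi.single (c ⟨v, h⟩) 1 else 0) x a =
        if x = glue O a c then 1 else 0 := by
    intro c x a
    unfold prepKets
    by_cases hx : x = glue O a c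
    · subst hx
      rw [if_pos (by funext i; simp), if_pos rfl]
      refine Finset.prod_eq_one fun i _ => ?_
      simp [i.2]
    · rw [if_neg hx]
      split_ifs with h
      · have : ∃ i : {v // v ∉ O}, x i ≠ c i := by
          by_contra! hc
          apply hx
          funext v
          by_cases hv : v ∈ O
          · simp [glue, hv, ← h]
          · simpa [glue, hv] using hc ⟨v, hv⟩
        obtain ⟨i, hi⟩ := this
        refine Finset.prod_eq_zero (Finset.mem_univ i) ?_
        simp [i.2, hi]
      · rfl
  ext a b
  simp only [Matrix.sum_apply, traceOut, conj, Matrix.conjTranspose_conjTranspose,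
    Matrix.mul_apply, Matrix.conjTranspose_apply, key]
  refine Finset.sum_congr rfl fun c _ => ?_
  simp
  rfl

end Registers

/-! ### One-qubit identities -/

section Qubit

theorem ofReal_sqrt_two_mul_self : ((Real.sqrt 2 : ℝ) : ℂ) * ((Real.sqrt 2 : ℝ) : ℂ) = 2 := by
  rw [← Complex.ofReal_mul, Real.mul_self_sqrt (by norm_num)]; norm_num

/-- The sign `(-1)^z` of a bit. -/
def sign (z : ZMod 2) : ℂ := (-1) ^ z.val

theorem sign_add (a b : ZMod 2) : sign (a + b) = sign a * sign b := by
  have : ∀ a b : ZMod 2, ((a + b).val : ℕ) % 2 = (a.val + b.val) % 2 := by decide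
  rw [sign, sign, sign, ← pow_add, neg_one_pow_eq_pow_mod_two, this,
    ← neg_one_pow_eq_pow_mod_two]

theorem sign_zero : sign 0 = 1 := by simp [sign]

theorem sign_sum {ι : Type*} (s : Finset ι) (a : ι → ZMod 2) :
    sign (∑ i ∈ s, a i) = ∏ i ∈ s, sign (a i) := by
  classical
  induction s using Finset.induction_on with
  | empty => simp [sign_zero]
  | insert i s hi ih => rw [Finset.sum_insert hi, Finset.prod_insert hi, sign_add, ih]

theorem sign_one : sign 1 = -1 := by simp [sign, ZMod.val_one]

theorem zmod_two_eq (x : ZMod 2) : x = 0 ∨ x = 1 := by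
  revert x; decide

theorem norm_sign (a : ZMod 2) : ‖sign a‖ = 1 := by simp [sign]

theorem sign_inv (a : ZMod 2) : (sign a)⁻¹ = sign a := by
  rw [sign, ← inv_pow, inv_neg, inv_one]

theorem exp_val_mul_pi (z : ZMod 2) :
    Complex.exp (Complex.I * ((z.val : ℂ) * (Real.pi : ℂ))) = sign z := by
  rw [sign, ← Complex.exp_pi_mul_I, ← Complex.exp_nat_mul]
  congr 1
  ring

/-- Angles are real numbers here, so equality modulo 2π is expressed through the phases. -/
theorem ketPlus_congr {θ θ' : ℝ}
    (h : Complex.exp (Complex.I * (θ : ℂ)) = Complex.exp (Complex.I * (θ' : ℂ))) :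
    ketPlus θ = ketPlus θ' := by
  simp [ketPlus, h]

theorem rotZ_mulVec_ketPlus (a θ : ℝ) : rotZ a *ᵥ ketPlus θ = ketPlus (θ + a) := by
  ext i
  fin_cases i <;> simp [rotZ, ketPlus, Matrix.mulVec, dotProduct, mul_add, Complex.exp_add]
  ring

theorem rotZ_zero : rotZ 0 = 1 := by
  ext i j; fin_cases i <;> fin_cases j <;> simp [rotZ]

theorem pauliZ_eq_rotZ : pauliZ = rotZ Real.pi := by
  simp [pauliZ, rotZ, mul_comm Complex.I]

theorem pauliX_mulVec_ketPlus (θ : ℝ) :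
    pauliX *ᵥ ketPlus θ = Complex.exp (Complex.I * (θ : ℂ)) • ketPlus (-θ) := by
  have := Complex.exp_ne_zero (Complex.I * (θ : ℂ))
  ext i
  fin_cases i <;> simp [pauliX, ketPlus, Complex.exp_neg]
  · ring
  · field_simp

theorem pauliZ_pow_mulVec_ketPlus (z : ZMod 2) (θ : ℝ) :
    pauliZ ^ z.val *ᵥ ketPlus θ = ketPlus (θ + (z.val : ℝ) * Real.pi) := by
  rw [pauliZ_eq_rotZ]
  induction z.val with
  | zero => simp
  | succ n ih =>
    rw [pow_succ', ← Matrix.mulVec_mulVec, ih, rotZ_mulVec_ketPlus]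
    push_cast
    ring_nf

theorem norm_exp_I_mul (θ : ℝ) : ‖Complex.exp (Complex.I * (θ : ℂ))‖ = 1 := by
  rw [mul_comm, Complex.norm_exp_ofReal_mul_I]

theorem pauliX_pow_mulVec_ketPlus (x : ZMod 2) (θ : ℝ) :
    ∃ c : ℂ, ‖c‖ = 1 ∧ pauliX ^ x.val *ᵥ ketPlus θ = c • ketPlus ((-1) ^ x.val * θ) := by
  have hx : x.val = 0 ∨ x.val = 1 := by have := x.val_lt; omega
  rcases hx with hx | hx <;> rw [hx]
  · exact ⟨1, by simp, by simp⟩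
  · exact ⟨_, norm_exp_I_mul θ, by simpa using pauliX_mulVec_ketPlus θ⟩

theorem pauliX_pow_mulVec_ketPlus_zero (x : ZMod 2) :
    pauliX ^ x.val *ᵥ ketPlus 0 = ketPlus 0 := by
  induction x.val with
  | zero => simp
  | succ n ih =>
    rw [pow_succ', ← Matrix.mulVec_mulVec, ih, pauliX_mulVec_ketPlus]
    simp

theorem star_ketPlus_dotProduct (θ : ℝ) : star (ketPlus θ) ⬝ᵥ ketPlus θ = 1 := by
  have h2 : (starRingEnd ℂ) (Complex.exp (Complex.I * (θ : ℂ))) *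
      Complex.exp (Complex.I * (θ : ℂ)) = 1 := by
    rw [← Complex.normSq_eq_conj_mul_self, Complex.normSq_eq_norm_sq, norm_exp_I_mul]; simp
  have h3 : ((Real.sqrt 2 : ℝ) : ℂ)⁻¹ * ((Real.sqrt 2 : ℝ) : ℂ)⁻¹ = 1 / 2 := by
    rw [← mul_inv, ofReal_sqrt_two_mul_self]; norm_num
  simp only [dotProduct, Fin.sum_univ_two, ketPlus, Pi.star_apply, Matrix.cons_val_zero,
    Matrix.cons_val_one, RCLike.star_def, map_mul, map_inv₀, Complex.conj_ofReal]
  linear_combination h3 + (((Real.sqrt 2 : ℝ) : ℂ)⁻¹ * ((Real.sqrt 2 : ℝ) : ℂ)⁻¹) * h2 + h3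

theorem projPlus_mulVec (θ : ℝ) (w : Fin 2 → ℂ) :
    projPlus θ *ᵥ w = (star (ketPlus θ) ⬝ᵥ w) • ketPlus θ := by
  ext i
  simp [projPlus, Matrix.vecMulVec_mulVec, mul_comm]

theorem projPlus_conjTranspose (θ : ℝ) : (projPlus θ)ᴴ = projPlus θ := by
  simp [projPlus, Matrix.conjTranspose_vecMulVec]

theorem projPlus_mul_self (θ : ℝ) : projPlus θ * projPlus θ = projPlus θ := by
  rw [projPlus, Matrix.vecMulVec_mul_vecMulVec, star_ketPlus_dotProduct, one_smul]

/-- Adding π negates e^{iθ}, so the off-diagonal entries cancel. -/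
theorem projPlus_add_pi (θ : ℝ) : projPlus θ + projPlus (θ + Real.pi) = 1 := by
  have h2 : Complex.exp (Complex.I * (θ : ℂ)) *
      (starRingEnd ℂ) (Complex.exp (Complex.I * (θ : ℂ))) = 1 := by
    rw [Complex.mul_conj, Complex.normSq_eq_norm_sq, norm_exp_I_mul]; simp
  have h3 : ((Real.sqrt 2 : ℝ) : ℂ)⁻¹ * ((Real.sqrt 2 : ℝ) : ℂ)⁻¹ = 1 / 2 := by
    rw [← mul_inv, ofReal_sqrt_two_mul_self]; norm_num
  have h4 : Complex.exp (Complex.I * ((θ + Real.pi : ℝ) : ℂ)) =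
      -Complex.exp (Complex.I * (θ : ℂ)) := by
    push_cast
    rw [mul_add, Complex.exp_add, mul_comm Complex.I (Real.pi : ℂ), Complex.exp_pi_mul_I]
    ring
  ext i j
  fin_cases i <;> fin_cases j <;>
    simp only [projPlus, Matrix.add_apply, Matrix.vecMulVec_apply, ketPlus, Pi.star_apply, h4,
      Fin.zero_eta, Fin.mk_one, Matrix.cons_val_zero, Matrix.cons_val_one, star_mul', star_neg,
      star_inv₀, RCLike.star_def, Complex.conj_ofReal, Matrix.one_apply] <;> simp
  · linear_combination 2 * h3
  · linear_combination 2 * h3 + (2 * ((Real.sqrt 2 : ℝ) : ℂ)⁻¹ * ((Real.sqrt 2 : ℝ) : ℂ)⁻¹) * h2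

theorem pauliX_unitary : pauliX ∈ Matrix.unitaryGroup (Fin 2) ℂ := by
  rw [Matrix.mem_unitaryGroup_iff]
  ext i j; fin_cases i <;> fin_cases j <;> simp [pauliX, Matrix.mul_apply]

theorem rotZ_unitary (a : ℝ) : rotZ a ∈ Matrix.unitaryGroup (Fin 2) ℂ := by
  rw [Matrix.mem_unitaryGroup_iff]
  have : Complex.exp (Complex.I * (a : ℂ)) *
      (starRingEnd ℂ) (Complex.exp (Complex.I * (a : ℂ))) = 1 := by
    rw [Complex.mul_conj, Complex.normSq_eq_norm_sq, norm_exp_I_mul]; simp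
  ext i j; fin_cases i <;> fin_cases j <;> simp [rotZ, Matrix.mul_apply, this]

theorem pauliZ_unitary : pauliZ ∈ Matrix.unitaryGroup (Fin 2) ℂ :=
  pauliZ_eq_rotZ ▸ rotZ_unitary _

/-- A basis label of one qubit as a bit. -/
def toBit (i : Fin 2) : ZMod 2 := i

@[simp] theorem toBit_zero : toBit 0 = 0 := rfl

@[simp] theorem toBit_one : toBit 1 = 1 := rfl

theorem pauliX_pow_apply (x : ZMod 2) (i j : Fin 2) :
    (pauliX ^ x.val) i j = if toBit i = toBit j + x then 1 else 0 := by
  rcases zmod_two_eq x with rfl | rfl <;> fin_cases i <;> fin_cases j <;>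
    simp [pauliX, ZMod.val_one, CharTwo.add_self_eq_zero]

theorem pauliZ_pow (z : ZMod 2) :
    pauliZ ^ z.val = Matrix.diagonal fun i : Fin 2 => sign (z * toBit i) := by
  rcases zmod_two_eq z with rfl | rfl <;> ext i j <;> fin_cases i <;> fin_cases j <;>
    simp [pauliZ, ZMod.val_one, sign_zero, sign_one]

/-- A Pauli operator squares to a sign. -/
theorem pauli_mul_self (x z : ZMod 2) :
    (pauliX ^ x.val * pauliZ ^ z.val) * (pauliX ^ x.val * pauliZ ^ z.val) =
      sign (x * z) • (1 : Matrix (Fin 2) (Fin 2) ℂ) := by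
  rcases zmod_two_eq x with rfl | rfl <;> rcases zmod_two_eq z with rfl | rfl <;>
    ext i j <;> fin_cases i <;> fin_cases j <;>
    simp [pauliZ, pauliX, ZMod.val_one, sign_zero, sign_one]

theorem pauli_unitary (x z : ZMod 2) :
    pauliX ^ x.val * pauliZ ^ z.val ∈ Matrix.unitaryGroup (Fin 2) ℂ :=
  mul_mem (pow_mem pauliX_unitary _) (pow_mem pauliZ_unitary _)

/-- How a rotated Pauli operator turns a measurement basis. -/
theorem rotZ_pauli_mulVec_ketPlus (x z : ZMod 2) (a θ γ : ℝ)
    (h : Complex.exp (Complex.I * (γ : ℂ)) = Complex.exp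
      (Complex.I * (((-1) ^ x.val * (θ + (z.val : ℝ) * Real.pi) + a : ℝ) : ℂ))) :
    ∃ c : ℂ, ‖c‖ = 1 ∧
      (rotZ a * (pauliX ^ x.val * pauliZ ^ z.val)) *ᵥ ketPlus θ = c • ketPlus γ := by
  obtain ⟨c, hc, hX⟩ := pauliX_pow_mulVec_ketPlus x (θ + (z.val : ℝ) * Real.pi)
  refine ⟨c, hc, ?_⟩
  rw [← Matrix.mulVec_mulVec, ← Matrix.mulVec_mulVec, pauliZ_pow_mulVec_ketPlus, hX,
    Matrix.mulVec_smul, rotZ_mulVec_ketPlus, ketPlus_congr h]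

end Qubit

/-! ### The entangling operator -/

section Entangle

variable {V : Type*}

theorem edge_sign (x : V → ZMod 2) (u v : V) [Decidable (∀ w ∈ s(u, v), x w = 1)] :
    (if ∀ w ∈ s(u, v), x w = 1 then (-1 : ℂ) else 1) = sign (x u * x v) := by
  have h : (∀ w ∈ s(u, v), x w = 1) ↔ x u = 1 ∧ x v = 1 := by
    simp
  simp only [h]
  rcases zmod_two_eq (x u) with h | h <;> rcases zmod_two_eq (x v) with h' | h' <;>
    simp [h, h', sign_zero, sign_one]

variable [Fintype V]

open scoped Classical in
/-- The sign of a bit string under `entangle`. -/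
noncomputable def entangleSign (G : SimpleGraph V) (x : V → ZMod 2) : ℂ :=
  ∏ e ∈ Finset.univ.filter (fun e : Sym2 V => e ∈ G.edgeSet),
    if ∀ v ∈ e, x v = 1 then (-1 : ℂ) else 1

theorem entangle_eq_diagonal (G : SimpleGraph V) [DecidableEq V] :
    entangle G = Matrix.diagonal fun x => entangleSign G fun v => toBit (x v) := by
  rfl

theorem norm_entangleSign (G : SimpleGraph V) (x : V → ZMod 2) : ‖entangleSign G x‖ = 1 := by
  rw [entangleSign, norm_prod]
  refine Finset.prod_eq_one fun e _ => ?_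
  split_ifs <;> simp

open scoped Classical in
/-- The sum of the bits at the neighbours. -/
noncomputable def neighborSum (G : SimpleGraph V) (x : V → ZMod 2) (v : V) : ZMod 2 :=
  ∑ u, if G.Adj u v then x u else 0

theorem neighborSum_add (G : SimpleGraph V) (x y : V → ZMod 2) (v : V) :
    neighborSum G (x + y) v = neighborSum G x v + neighborSum G y v := by
  simp only [neighborSum, ← Finset.sum_add_distrib]
  exact Finset.sum_congr rfl fun u _ => by split_ifs <;> simp

/-- Polarization of the quadratic form: an edge {u, v} contributes the cross terms x_u y_v + x_v
y_u, one for each orientation. -/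
theorem entangleSign_add (G : SimpleGraph V) (x y : V → ZMod 2) :
    entangleSign G (x + y) =
      entangleSign G x * entangleSign G y * ∏ v, sign (neighborSum G x v * y v) := by
  classical
  have h : ∏ v, sign (neighborSum G x v * y v) =
      ∏ p ∈ Finset.univ.filter (fun p : V × V => G.Adj p.1 p.2), sign (x p.1 * y p.2) := by
    rw [Finset.prod_filter, Fintype.prod_prod_type_right]
    refine Finset.prod_congr rfl fun v _ => ?_
    rw [neighborSum, Finset.sum_mul, sign_sum]
    exact Finset.prod_congr rfl fun u _ => by split_ifs <;> simp [sign_zero]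
  -- The ordered adjacent pairs are grouped by their underlying edge; each fibre consists of the two
  -- orientations.
  rw [h, ← Finset.prod_fiberwise_of_maps_to
    (t := Finset.univ.filter (fun e : Sym2 V => e ∈ G.edgeSet)) (g := fun p => s(p.1, p.2))
    (by simp)]
  unfold entangleSign
  rw [← Finset.prod_mul_distrib, ← Finset.prod_mul_distrib]
  refine Finset.prod_congr rfl fun e he => ?_
  induction e with
  | h u v =>
    have huv : G.Adj u v := by simpa using he
    have hf : (Finset.univ.filter fun p : V × V => G.Adj p.1 p.2).filter
        (fun p => s(p.1, p.2) = s(u, v)) = {(u, v), (v, u)} := by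
      ext ⟨a, b⟩
      simp only [Finset.mem_filter, Finset.mem_univ, true_and, Sym2.eq_iff, Finset.mem_insert,
        Finset.mem_singleton, Prod.mk.injEq]
      constructor
      · exact fun h => h.2
      · rintro (⟨rfl, rfl⟩ | ⟨rfl, rfl⟩)
        · exact ⟨huv, Or.inl ⟨rfl, rfl⟩⟩
        · exact ⟨huv.symm, Or.inr ⟨rfl, rfl⟩⟩
    rw [hf, Finset.prod_pair (by simp [huv.ne])]
    rw [edge_sign, edge_sign, edge_sign]
    simp only [Pi.add_apply, ← sign_add]
    congr 1
    ring

/-- X^x shifts basis labels by x, and the polar term in `entangleSign_add` is the eigenvalue of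
Z^{Nx}. -/
theorem entangle_mul_pauliX [DecidableEq V] (G : SimpleGraph V) (x : V → ZMod 2) :
    entangle G * tensorOp (fun v => pauliX ^ (x v).val) =
      entangleSign G x • (tensorOp (fun v => pauliX ^ (x v).val *
        pauliZ ^ (neighborSum G x v).val) * entangle G) := by
  ext y y'
  rw [entangle_eq_diagonal]
  simp only [Matrix.diagonal_mul, Matrix.mul_diagonal, Matrix.smul_apply, tensorOp, pauliZ_pow,
    smul_eq_mul, pauliX_pow_apply]
  rw [Finset.prod_mul_distrib]
  by_cases h : ∀ v, toBit (y v) = toBit (y' v) + x v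
  · have hy : (fun v => toBit (y v)) = x + fun v => toBit (y' v) :=
      funext fun v => (h v).trans (add_comm _ _)
    rw [Finset.prod_eq_one fun v _ => if_pos (h v), hy, entangleSign_add]
    ring
  · push Not at h
    obtain ⟨v, hv⟩ := h
    rw [Finset.prod_eq_zero (Finset.mem_univ v) (if_neg hv)]
    simp

theorem entangle_unitary [DecidableEq V] (G : SimpleGraph V) :
    (entangle G)ᴴ * entangle G = 1 := by
  rw [entangle_eq_diagonal, Matrix.diagonal_conjTranspose, Matrix.diagonal_mul_diagonal,
    ← Matrix.diagonal_one]
  congr 1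
  funext x
  have := norm_entangleSign G fun v => toBit (x v)
  simp [← Complex.normSq_eq_conj_mul_self, Complex.normSq_eq_norm_sq, this]

theorem entangle_mul_rotZ [DecidableEq V] (G : SimpleGraph V) (a : V → ℝ) :
    entangle G * tensorOp (fun v => rotZ (a v)) = tensorOp (fun v => rotZ (a v)) * entangle G := by
  have : tensorOp (fun v => rotZ (a v)) = Matrix.diagonal fun x : V → Fin 2 =>
      ∏ v, rotZ (a v) (x v) (x v) := by
    ext x y
    by_cases h : x = y
    · subst h; simp [tensorOp]
    · obtain ⟨v, hv⟩ := Function.ne_iff.1 h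
      rw [Matrix.diagonal_apply_ne _ h]
      refine Finset.prod_eq_zero (Finset.mem_univ v) ?_
      revert hv
      generalize x v = i
      generalize y v = j
      fin_cases i <;> fin_cases j <;> simp [rotZ]
  rw [entangle_eq_diagonal, this, Matrix.diagonal_mul_diagonal, Matrix.diagonal_mul_diagonal]
  simp [mul_comm]

end Entangle

/-! ### Moving operators through the projections on fresh qubits -/

section Registers

variable {V : Type*} [Fintype V] [DecidableEq V]

/-- This is the adjoint of `tensorOp_mul_prepKets`, with the unitary D moved to the other side. The
phase c is kept unspecified because only its modulus matters. -/
theorem prepKets_conjTranspose_mul_tensorOp {S : Finset V} {D : V → Matrix (Fin 2) (Fin 2) ℂ}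
    {k k' : V → Fin 2 → ℂ} (hD : ∀ v, D v ∈ Matrix.unitaryGroup (Fin 2) ℂ)
    (h : ∀ v, v ∉ S → ∃ c : ℂ, ‖c‖ = 1 ∧ D v *ᵥ k v = c • k' v) :
    ∃ c : ℂ, ‖c‖ = 1 ∧ (prepKets S k')ᴴ * tensorOp D =
      c • (tensorOp (fun i : S => D i) * (prepKets S k)ᴴ) := by
  -- The phases are extended by 1 to S, so that `choose` yields a function on all of V.
  have h' : ∀ v, ∃ c : ℂ, ‖c‖ = 1 ∧ (v ∉ S → D v *ᵥ k v = c • k' v) := by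
    intro v
    by_cases hv : v ∈ S
    · exact ⟨1, by simp, by simp [hv]⟩
    · obtain ⟨c, h1, h2⟩ := h v hv
      exact ⟨c, h1, fun _ => h2⟩
  choose c hc hk using h'
  have hn : ‖∏ i : {v // v ∉ S}, c i‖ = 1 := by simp [norm_prod, hc]
  have hcc : star (∏ i : {v // v ∉ S}, c i) * ∏ i : {v // v ∉ S}, c i = 1 := by
    rw [RCLike.star_def, ← Complex.normSq_eq_conj_mul_self, Complex.normSq_eq_norm_sq, hn]
    simp
  refine ⟨_, hn, ?_⟩
  have hS : tensorOp (fun i : S => D i) * (tensorOp (fun i : S => D i))ᴴ = 1 := by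
    rw [tensorOp_conjTranspose, tensorOp_mul]
    simp only [Matrix.mem_unitaryGroup_iff.1 (hD _), ← Matrix.star_eq_conjTranspose, tensorOp_one]
  have hV : (tensorOp D)ᴴ * tensorOp D = 1 :=
    tensorOp_unitary fun v => Matrix.mem_unitaryGroup_iff'.1 (hD v)
  have key : tensorOp D * prepKets S k =
      (∏ i : {v // v ∉ S}, c i) • (prepKets S k' * tensorOp fun i : S => D i) := by
    rw [tensorOp_mul_prepKets, prepKets_congr hk, prepKets_smul, Matrix.smul_mul]
  have key' := congrArg Matrix.conjTranspose
    (congrArg (fun M => M * (tensorOp fun i : S => D i)ᴴ) key)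
  simp only [Matrix.mul_assoc, Matrix.smul_mul, hS, Matrix.mul_one, Matrix.conjTranspose_mul,
    Matrix.conjTranspose_conjTranspose, Matrix.conjTranspose_smul] at key'
  have hC : ∀ M : QMap S V, (∏ i : {v // v ∉ S}, c i) • star (∏ i : {v // v ∉ S}, c i) • M = M :=
    fun M => by rw [smul_smul, mul_comm, hcc, one_smul]
  rw [← hC (prepKets S k')ᴴ, ← key', Matrix.smul_mul, Matrix.mul_assoc, Matrix.mul_assoc, hV,
    Matrix.mul_one]

end Registers

/-- Modulo 2π, π and -π agree, so multiples of π pass through the signs and add up as bits. In the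
application x, z are signals, x', z' pads, w the reported outcome and r the key, so that w + r is
the decrypted outcome. -/
theorem exp_adapted_angle (x x' z z' w r : ZMod 2) (θ a : ℝ) :
    Complex.exp (Complex.I * (((-1) ^ x.val * ((-1) ^ x'.val * θ + (z'.val : ℝ) * Real.pi) +
      (z.val : ℝ) * Real.pi + Real.pi * (r.val : ℝ) + a + (w.val : ℝ) * Real.pi : ℝ) : ℂ)) =
    Complex.exp (Complex.I * (((-1) ^ (x + x').val *
      (θ + ((z + z' + (w + r)).val : ℝ) * Real.pi) + a : ℝ) : ℂ)) := by
  have h : ∀ u : ZMod 2, Complex.exp (Complex.I * (Real.pi : ℂ) * (u.val : ℂ)) = sign u :=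
    fun u => by rw [← exp_val_mul_pi]; congr 1; ring
  have h' : ∀ u : ZMod 2, Complex.exp (-(Complex.I * (Real.pi : ℂ) * (u.val : ℂ))) = sign u :=
    fun u => by rw [Complex.exp_neg, h, sign_inv]
  have h₂ : ∀ u : ZMod 2, Complex.exp (Complex.I * (u.val : ℂ) * (Real.pi : ℂ)) = sign u :=
    fun u => by rw [mul_right_comm, h]
  have h₂' : ∀ u : ZMod 2, Complex.exp (-(Complex.I * (u.val : ℂ) * (Real.pi : ℂ))) = sign u :=
    fun u => by rw [mul_right_comm, h']
  generalize hq : z + z' + (w + r) = q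
  have hs : sign q = sign z * sign z' * (sign w * sign r) := by
    rw [← hq, sign_add, sign_add, sign_add]
  have e : ∀ ε : ℝ, (ε = 1 ∨ ε = -1) → ∀ ε' : ℝ, (ε' = 1 ∨ ε' = -1) →
      Complex.exp (Complex.I * ((ε * (ε' * θ + (z'.val : ℝ) * Real.pi) +
        (z.val : ℝ) * Real.pi + Real.pi * (r.val : ℝ) + a + (w.val : ℝ) * Real.pi : ℝ) : ℂ)) =
      Complex.exp (Complex.I * (((ε * ε') * (θ + (q.val : ℝ) * Real.pi) + a : ℝ) : ℂ)) := by
    rintro ε (rfl | rfl) ε' (rfl | rfl)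
    all_goals
      push_cast
      ring_nf
      simp only [Complex.exp_add, sub_eq_add_neg, h, h', h₂, h₂', hs]
      ring
  have hx : ∀ x : ZMod 2, (-1 : ℝ) ^ x.val = 1 ∨ (-1 : ℝ) ^ x.val = -1 :=
    fun x => neg_one_pow_eq_or ℝ _
  have hxx : (-1 : ℝ) ^ (x + x').val = (-1) ^ x.val * (-1) ^ x'.val := by
    have := sign_add x x'
    simp only [sign] at this
    exact_mod_cast this
  rw [hxx, e _ (hx x) _ (hx x')]

/-! ### Signals as neighbour sums, and their causality -/

namespace Setup

variable {V : Type*} [Fintype V] [DecidableEq V] (P : Setup V)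

theorem neighborSum_pushforward {κ : Type*} [Fintype κ] (G : SimpleGraph V) (g : κ → V)
    (s : κ → ZMod 2) (v : V) [∀ k, Decidable (G.Adj (g k) v)] :
    neighborSum G (fun i => ∑ k, if g k = i then s k else 0) v =
      ∑ k, if G.Adj (g k) v then s k else 0 := by
  classical
  simp only [neighborSum]
  rw [Finset.sum_congr rfl fun u _ => show (if G.Adj u v then ∑ k, if g k = u then s k else 0
    else 0) = ∑ k, if g k = u then (if G.Adj u v then s k else 0) else 0 by
      split_ifs <;> simp, Finset.sum_comm]
  refine Finset.sum_congr rfl fun k _ => ?_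
  rw [Finset.sum_ite_eq]
  simp

theorem neighborSum_xPad (t : P.I → ZMod 2) (v : V) :
    neighborSum P.G (P.xPad t) v = P.zPad t v := by
  classical
  have : P.xPad t = fun i => ∑ k : P.I, if (k : V) = i then t k else 0 := by
    funext i
    by_cases h : i ∈ P.I
    · rw [xPad, dif_pos h, Finset.sum_eq_single ⟨i, h⟩] <;> simp [Subtype.ext_iff]
      intro a _ ha ha'
      exact absurd ha' ha
    · rw [xPad, dif_neg h, Finset.sum_eq_zero]
      rintro ⟨k, hk⟩ _
      rw [if_neg]
      rintro rfl
      exact h hk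
  rw [this, neighborSum_pushforward, zPad]

/-- The flow conditions enter here. The left side sums s_k over all k with v ∈ N(f k). Such a k is v
itself or satisfies k ≺ v. The latter terms form z(v); the term k = v occurs for every measured v,
and irreflexivity keeps it out of z(v). -/
theorem neighborSum_xSignal (s : P.Record) (v : V) :
    neighborSum P.G (P.xSignal s) v = P.zSignal s v + if h : v ∉ P.O then s ⟨v, h⟩ else 0 := by
  classical
  have h1 : (if h : v ∉ P.O then s ⟨v, h⟩ else 0) =
      ∑ k : P.Measured, if (k : V) = v then s k else 0 := by
    by_cases h : v ∉ P.O
    · rw [dif_pos h, Finset.sum_eq_single ⟨v, h⟩] <;> simp [Subtype.ext_iff]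
      intro a _ ha ha'
      exact absurd ha' ha
    · rw [dif_neg h, Finset.sum_eq_zero]
      rintro ⟨k, hk⟩ _
      rw [if_neg]
      rintro rfl
      exact h hk
  have h2 : P.xSignal s = fun i => ∑ k : P.Measured, if (P.f k : V) = i then s k else 0 := rfl
  rw [h1, h2, neighborSum_pushforward, zSignal, ← Finset.sum_add_distrib]
  refine Finset.sum_congr rfl fun k _ => ?_
  by_cases hk : (k : V) = v
  · subst hk
    have := P.flow.strict
    simp [(P.flow.adj k).symm, irrefl_of P.prec (k : V)]
  · by_cases ha : P.G.Adj (P.f k) v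
    · simp [ha, hk, P.flow.lt_neighbor k v ha (Ne.symm hk)]
    · simp [ha, hk]

theorem neighborSum_xByproduct (t : P.I → ZMod 2) (s : P.Record) (v : V) :
    neighborSum P.G (P.xSignal s + P.xPad t) v =
      P.zSignal s v + P.zPad t v + if h : v ∉ P.O then s ⟨v, h⟩ else 0 := by
  rw [neighborSum_add, neighborSum_xPad, neighborSum_xSignal]
  ring

theorem xSignal_input (s : P.Record) {v : V} (hv : v ∈ P.I) : P.xSignal s v = 0 := by
  refine Finset.sum_eq_zero fun k _ => if_neg ?_
  rintro rfl
  exact (P.f k).2 hv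

theorem xSignal_congr {s s' : P.Record} {i : V} (h : ∀ k : P.Measured, P.prec k i → s k = s' k) :
    P.xSignal s i = P.xSignal s' i := by
  refine Finset.sum_congr rfl fun k _ => ?_
  split_ifs with hk
  · exact h k (hk ▸ P.flow.lt k)
  · rfl

theorem zSignal_congr {s s' : P.Record} {i : V} (h : ∀ k : P.Measured, P.prec k i → s k = s' k) :
    P.zSignal s i = P.zSignal s' i := by
  refine Finset.sum_congr rfl fun k _ => ?_
  split_ifs with hk
  · exact h k hk.1
  · rfl

variable (r : P.Record) (t : P.I → ZMod 2) (φ α : P.AliceNode → Omega P.b)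
  (ψ β : P.OscarNode → Omega P.b)

theorem prepAngle_eq :
    P.prepAngle (P.alice r t φ α) (P.oscar r t ψ β) = P.angles α β := by
  funext v
  unfold prepAngle angles
  rfl

theorem announced_eq (m : P.Record) (i : P.Measured) :
    P.announced (P.alice r t φ α) (P.oscar r t ψ β) m i =
      P.adaptAngle (m + r) i (P.padAngle t i (P.angles φ ψ i)) + Real.pi * ((r i).val : ℝ) +
        P.angles α β i := by
  unfold announced angles
  by_cases h : i.1 ∈ P.VA <;> simp [h, i.2, alice, oscar]

/-- Causality: it allows the partial record to be replaced by the full outcome string ω. -/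
theorem announced_congr {m m' : P.Record} {i : P.Measured}
    (h : ∀ k : P.Measured, P.prec k i → m k = m' k) :
    P.announced (P.alice r t φ α) (P.oscar r t ψ β) m i =
      P.announced (P.alice r t φ α) (P.oscar r t ψ β) m' i := by
  have h' : ∀ k : P.Measured, P.prec k i → (m + r) k = (m' + r) k := fun k hk => by
    simp [h k hk]
  rw [announced_eq, announced_eq, adaptAngle, adaptAngle, P.xSignal_congr h', P.zSignal_congr h']

/-! ### The measurement phase -/

/-- The angle of the basis vector found at a measured node in the branch with outcomes `ω`. -/
noncomputable def outcomeAngle (A : P.AliceConverter) (B : P.OscarConverter) (ω : P.Record)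
    (v : V) : ℝ :=
  if h : v ∉ P.O then P.announced A B ω ⟨v, h⟩ + ((ω ⟨v, h⟩).val : ℝ) * Real.pi else 0

open scoped Classical in
-- By causality each projector depends on ω alone, and projectors on distinct qubits combine into
-- one tensor product.
theorem measureAll_eq_conj (ω : P.Record) (l : List P.Measured) (hd : l.Nodup)
    (hp : l.Pairwise fun i j : P.Measured => ¬ P.prec j i) (m : P.Record) (hm : ∀ k, k ∉ l → m k = ω k)
    (σ : QOp V) :
    P.measureAll (P.alice r t φ α) (P.oscar r t ψ β) ω l m σ =
      conj (tensorOp fun v => if ∃ h : v ∉ P.O, (⟨v, h⟩ : P.Measured) ∈ l then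
        projPlus (P.outcomeAngle (P.alice r t φ α) (P.oscar r t ψ β) ω v) else 1) σ := by
  induction l generalizing m σ with
  | nil => simp [measureAll, tensorOp_one, conj]
  | cons i l ih =>
    rw [List.nodup_cons] at hd
    rw [List.pairwise_cons] at hp
    -- A predecessor of i cannot occur in the rest of the list, so its outcome is already recorded.
    have hi : ∀ k : P.Measured, P.prec k i → m k = ω k := by
      intro k hk
      apply hm
      rw [List.mem_cons]
      rintro (rfl | h)
      · have := P.flow.strict
        exact irrefl_of P.prec (k : V) hk
      · exact hp.1 k h hk
    rw [measureAll, ih hd.2 hp.2, conj_conj, onQubit, tensorOp_mul, P.announced_congr _ _ _ _ _ _ hi]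
    · congr 2
      funext v
      by_cases hv : v = i
      · subst hv
        simp [hd.1, outcomeAngle, i.2]
      · have : ∀ h : v ∉ P.O, (⟨v, h⟩ : P.Measured) ≠ i := fun h h' => hv (congrArg Subtype.val h')
        simp [Function.update_of_ne hv, this]
    · intro k hk
      by_cases hki : k = i
      · subst hki; simp
      · rw [Function.update_of_ne hki]
        exact hm k (by simp [hki, hk])

theorem measureAll_schedule (ω : P.Record) {l : List P.Measured} (hl : P.IsSchedule l)
    (σ : QOp V) :
    P.measureAll (P.alice r t φ α) (P.oscar r t ψ β) ω l 0 σ =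
      conj (tensorOp fun v => if v ∉ P.O then
        projPlus (P.outcomeAngle (P.alice r t φ α) (P.oscar r t ψ β) ω v) else 1) σ := by
  have hp : l.Pairwise fun i j : P.Measured => ¬ P.prec j i := by
    have h := hl.consistent
    -- In `IsSchedule.consistent` the list is coerced to a list of nodes of V by a monadic map,
    -- which has to be undone.
    have h' : (do let a ← l; pure (a : V)) = l.map Subtype.val := by
      simp
    rw [h'] at h
    exact List.pairwise_map.1 h
  rw [measureAll_eq_conj _ _ _ _ _ _ _ _ _ hl.nodup hp _
    fun k hk => absurd (hl.complete k) hk]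
  congr 2
  funext v
  simp [hl.complete]

end Setup

/-- Discarding qubits that have been projected onto `|+_γ⟩`. -/
theorem traceOut_conj_projPlus {V : Type*} [Fintype V] [DecidableEq V] (O : Finset V) (γ : V → ℝ)
    (σ : QOp V) :
    traceOut O (conj (tensorOp fun v => if v ∉ O then projPlus (γ v) else 1) σ) =
      conj (prep O γ)ᴴ σ := by
  -- Each ⟨c| meets |+_γ⟩⟨+_γ| and leaves an amplitude times ⟨+_γ|; the squared moduli of the
  -- amplitudes sum to 1 in `h4`.
  have h1 : ∀ c : {v // v ∉ O} → Fin 2,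
      (prepKets O fun v => if h : v ∉ O then Pi.single (c ⟨v, h⟩) 1 else 0)ᴴ *
        tensorOp (fun v => if v ∉ O then projPlus (γ v) else 1) =
      (∏ i, ketPlus (γ (i : {v // v ∉ O})) (c i)) • (prep O γ)ᴴ := by
    intro c
    have h2 : tensorOp (fun v => if v ∉ O then projPlus (γ v) else 1) =
        (tensorOp fun v => if v ∉ O then projPlus (γ v) else 1)ᴴ := by
      rw [tensorOp_conjTranspose]
      congr 1
      funext v
      split_ifs <;> simp [projPlus_conjTranspose]
    have h3 : (tensorOp fun i : O => if (i : V) ∉ O then projPlus (γ i) else 1) = 1 := by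
      simp [tensorOp_one]
    rw [h2, ← Matrix.conjTranspose_mul, tensorOp_mul_prepKets, h3, Matrix.mul_one,
      prepKets_congr (k' := fun v => (if h : v ∉ O then star (ketPlus (γ v) (c ⟨v, h⟩)) else 1) •
        ketPlus (γ v)), prepKets_smul, Matrix.conjTranspose_smul, prep_eq_prepKets]
    · congr 1
      rw [star_prod]
      exact Finset.prod_congr rfl fun i _ => by simp [i.2]
    · intro v hv
      simp only [hv, not_false_eq_true, if_true, dite_true, projPlus_mulVec]
      congr 1
      simp
  rw [traceOut_eq_sum]
  simp only [conj_conj, h1, conj_smul, ← Finset.sum_smul]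
  have h4 : ∑ c : {v // v ∉ O} → Fin 2, (∏ i, ketPlus (γ (i : {v // v ∉ O})) (c i)) *
      star (∏ i, ketPlus (γ (i : {v // v ∉ O})) (c i)) =
        ∏ i : {v // v ∉ O}, star (ketPlus (γ i)) ⬝ᵥ ketPlus (γ i) := by
    simp only [dotProduct]
    rw [Finset.prod_univ_sum]
    simp [Fintype.piFinset_univ, star_prod, ← Finset.prod_mul_distrib, mul_comm]
  rw [h4, Finset.prod_eq_one fun i _ => star_ketPlus_dotProduct _, one_smul]

namespace Setup

variable {V : Type*} [Fintype V] [DecidableEq V] (P : Setup V)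
variable (r : P.Record) (t : P.I → ZMod 2) (φ α : P.AliceNode → Omega P.b)
  (ψ β : P.OscarNode → Omega P.b)

/-! ### Each branch -/

/-- Here X^{xSignal s} is inserted for free, for an arbitrary s that is later taken to be ω + r. -/
theorem prep_mul_encrypt (s : P.Record) :
    prep P.I (P.angles α β) * (P.alice r t φ α).encrypt =
      tensorOp (fun v => rotZ (P.angles α β v) * pauliX ^ ((P.xSignal s + P.xPad t) v).val) *
        prep P.I (fun _ => 0) := by
  rw [prep_eq_prepKets, prep_eq_prepKets, tensorOp_mul_prepKets]
  congr 1
  · congr 1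
    funext v
    rw [← Matrix.mulVec_mulVec, pauliX_pow_mulVec_ketPlus_zero, rotZ_mulVec_ketPlus, zero_add]
  · simp only [alice]
    congr 1
    funext i
    have hA := P.input_subset i.2
    by_cases h : (i : V) ∉ P.O
    · simp [h, angles, hA, P.xSignal_input s i.2, xPad]
    · simp [h, angles, P.xSignal_input s i.2, xPad, rotZ_zero]

/-- At an output no rotation and no term s_v is present, so byproduct and correction are the same
Pauli, whose square is a sign. -/
theorem correct_mul_byproduct (ω : P.Record) :
    ∃ c : ℂ, ‖c‖ = 1 ∧ (P.alice r t φ α).correct ω *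
      tensorOp (fun i : P.O => rotZ (P.angles α β i) *
        (pauliX ^ ((P.xSignal (ω + r) + P.xPad t) i).val *
          pauliZ ^ (neighborSum P.G (P.xSignal (ω + r) + P.xPad t) i).val)) = c • 1 := by
  refine ⟨∏ i : P.O, sign ((P.xSignal (ω + r) i + P.xPad t i) *
    (P.zSignal (ω + r) i + P.zPad t i)), by simp [norm_prod, norm_sign], ?_⟩
  simp only [alice, tensorOp_mul]
  rw [← tensorOp_one, ← tensorOp_smul]
  congr 1
  funext i
  have hi : ¬ ((i : V) ∉ P.O) := not_not.2 i.2
  rw [neighborSum_xByproduct, dif_neg hi, angles, dif_neg hi, rotZ_zero, one_mul, add_zero]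
  exact pauli_mul_self _ _

theorem kraus_eq_smul_patternMap (ω : P.Record) :
    ∃ c : ℂ, ‖c‖ = 1 ∧ (P.alice r t φ α).correct ω *
      ((prep P.O (P.outcomeAngle (P.alice r t φ α) (P.oscar r t ψ β) ω))ᴴ *
        (entangle P.G * (prep P.I (P.angles α β) * (P.alice r t φ α).encrypt))) =
      c • P.patternMap (P.angles φ ψ) := by
  set x := P.xSignal (ω + r) + P.xPad t with hx
  obtain ⟨c, hc, hC⟩ := P.correct_mul_byproduct r t φ α β ω
  obtain ⟨d, hd, hD⟩ := prepKets_conjTranspose_mul_tensorOp (S := P.O)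
    (D := fun v => rotZ (P.angles α β v) *
      (pauliX ^ (x v).val * pauliZ ^ (neighborSum P.G x v).val))
    (k := fun v => ketPlus (P.angles φ ψ v))
    (k' := fun v => ketPlus (P.outcomeAngle (P.alice r t φ α) (P.oscar r t ψ β) ω v))
    (fun v => mul_mem (rotZ_unitary _) (pauli_unitary _ _)) (by
      intro v hv
      apply rotZ_pauli_mulVec_ketPlus
      rw [outcomeAngle, dif_pos hv, announced_eq, adaptAngle, padAngle, exp_adapted_angle, hx,
        neighborSum_xByproduct, dif_pos hv]
      rfl)
  refine ⟨d * (entangleSign P.G x * c), by simp [hc, hd, norm_entangleSign], ?_⟩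
  rw [P.prep_mul_encrypt r t φ α β (ω + r), ← hx]
  have h1 : tensorOp (fun v => rotZ (P.angles α β v) * pauliX ^ (x v).val) =
      tensorOp (fun v => rotZ (P.angles α β v)) * tensorOp (fun v => pauliX ^ (x v).val) :=
    (tensorOp_mul _ _).symm
  have h2 : entangle P.G * tensorOp (fun v => rotZ (P.angles α β v) * pauliX ^ (x v).val) =
      entangleSign P.G x • (tensorOp (fun v => rotZ (P.angles α β v) *
        (pauliX ^ (x v).val * pauliZ ^ (neighborSum P.G x v).val)) * entangle P.G) := by
    rw [h1, ← Matrix.mul_assoc, entangle_mul_rotZ, Matrix.mul_assoc, entangle_mul_pauliX,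
      Matrix.mul_smul, ← Matrix.mul_assoc, tensorOp_mul]
  rw [← prep_eq_prepKets, ← prep_eq_prepKets] at hD
  rw [← Matrix.mul_assoc (entangle P.G), h2, Matrix.smul_mul, Matrix.mul_smul, Matrix.mul_smul,
    Matrix.mul_assoc (tensorOp _), ← Matrix.mul_assoc (prep P.O _)ᴴ, hD, Matrix.smul_mul,
    Matrix.mul_smul, Matrix.mul_assoc (tensorOp _), ← Matrix.mul_assoc (AliceConverter.correct _ _),
    hC, Matrix.smul_mul, Matrix.one_mul, smul_smul, smul_smul, patternMap, Matrix.mul_assoc]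
  congr 1
  ring

theorem isometry_conj (θ : V → ℝ) (ρ : QOp P.I) :
    conj (P.isometry θ) ρ = (2 : ℂ) ^ Fintype.card P.Measured • conj (P.patternMap θ) ρ := by
  rw [isometry, conj_smul, star_pow, ← mul_pow, RCLike.star_def, Complex.conj_ofReal,
    ofReal_sqrt_two_mul_self]

theorem execute_eq {l : List P.Measured} (hl : P.IsSchedule l) (ω : P.Record) (ρ : QOp P.I) :
    P.execute (P.alice r t φ α) (P.oscar r t ψ β) l ω ρ =
      ((2 : ℂ) ^ Fintype.card P.Measured)⁻¹ • conj (P.isometry (P.angles φ ψ)) ρ := by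
  obtain ⟨c, hc, h⟩ := P.kraus_eq_smul_patternMap r t φ α ψ β ω
  have hcc : c * star c = 1 := by
    rw [RCLike.star_def, Complex.mul_conj, Complex.normSq_eq_norm_sq, hc]; simp
  rw [execute, prepAngle_eq, P.measureAll_schedule _ _ _ _ _ _ _ hl, traceOut_conj_projPlus,
    conj_conj, conj_conj, conj_conj, conj_conj]
  simp only [Matrix.mul_assoc] at h ⊢
  rw [h, conj_smul, hcc, one_smul, isometry_conj, smul_smul, inv_mul_cancel₀ (pow_ne_zero _ two_ne_zero),
    one_smul]

theorem card_record : Fintype.card P.Record = 2 ^ Fintype.card P.Measured := by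
  simp [ZMod.card]

theorem executeAll_eq {l : List P.Measured} (hl : P.IsSchedule l) (ρ : QOp P.I) :
    P.executeAll (P.alice r t φ α) (P.oscar r t ψ β) l ρ =
      conj (P.isometry (P.angles φ ψ)) ρ := by
  have h : (2 : ℂ) ^ Fintype.card P.Measured ≠ 0 := pow_ne_zero _ two_ne_zero
  rw [executeAll, Finset.sum_congr rfl fun ω _ => P.execute_eq r t φ α ψ β hl ω ρ,
    Finset.sum_const, Finset.card_univ, card_record, ← Nat.cast_smul_eq_nsmul ℂ, smul_smul]
  push_cast
  rw [mul_inv_cancel₀ h, one_smul]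

theorem protocol_eq {l : List P.Measured} (hl : P.IsSchedule l) (ρ : QOp P.I) :
    P.protocol φ ψ l ρ = conj (P.isometry (P.angles φ ψ)) ρ := by
  -- The secret angles φ, ψ themselves serve as admissible random angles.
  have : Nonempty (P.Record × (P.I → ZMod 2) × (P.AliceNode → Omega P.b) ×
    (P.OscarNode → Omega P.b)) := ⟨0, 0, φ, ψ⟩
  rw [protocol, Finset.sum_congr rfl fun k _ => P.executeAll_eq k.1 k.2.1 φ k.2.2.1 ψ k.2.2.2 hl ρ,
    Finset.sum_const, Finset.card_univ, ← Nat.cast_smul_eq_nsmul ℂ, smul_smul,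
    inv_mul_cancel₀ (by exact_mod_cast Fintype.card_ne_zero), one_smul]

/-! ### The isometry -/

theorem onQubit_projPlus_conjTranspose_mul_self (i : V) (γ : ℝ) :
    (onQubit i (projPlus γ))ᴴ * onQubit i (projPlus γ) = onQubit i (projPlus γ) := by
  rw [onQubit, tensorOp_conjTranspose, tensorOp_mul]
  congr 1
  funext v
  by_cases h : v = i
  · subst h; simp [projPlus_conjTranspose, projPlus_mul_self]
  · simp [Function.update_of_ne h]

theorem onQubit_add (i : V) (A B : Matrix (Fin 2) (Fin 2) ℂ) :
    onQubit i (A + B) = onQubit i A + onQubit i B := by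
  ext x y
  simp only [onQubit, tensorOp, Matrix.add_apply,
    ← Finset.mul_prod_erase Finset.univ _ (Finset.mem_univ i), Function.update_self]
  rw [add_mul]
  congr 2 <;> refine Finset.prod_congr rfl fun v hv => ?_ <;>
    simp [Function.update_of_ne (Finset.ne_of_mem_erase hv)]

theorem onQubit_one (i : V) : onQubit i 1 = 1 := by
  rw [onQubit, ← tensorOp_one]
  congr 1
  exact Function.update_eq_self i _

/-- The probabilities of the two outcomes add up to one. -/
theorem sum_trace_conj_projPlus (i : V) (γ : ℝ) (σ : QOp V) :
    ∑ b : ZMod 2, (conj (onQubit i (projPlus (γ + (b.val : ℝ) * Real.pi))) σ).trace =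
      σ.trace := by
  simp only [trace_conj, onQubit_projPlus_conjTranspose_mul_self]
  have : (Finset.univ : Finset (ZMod 2)) = {0, 1} := rfl
  rw [this, Finset.sum_pair (by decide), ← Matrix.trace_add, ← Matrix.add_mul, ← onQubit_add]
  simp [ZMod.val_one, projPlus_add_pi, onQubit_one]

theorem measureAll_congr (A : P.AliceConverter) (B : P.OscarConverter) {ω ω' : P.Record}
    (l : List P.Measured) (h : ∀ i ∈ l, ω i = ω' i) (m : P.Record) (σ : QOp V) :
    P.measureAll A B ω l m σ = P.measureAll A B ω' l m σ := by
  induction l generalizing m σ with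
  | nil => rfl
  | cons i l ih =>
    rw [measureAll, measureAll, h i (by simp), ih fun j hj => h j (by simp [hj])]

/-- Flipping the bit ω_i permutes the records and changes only the first argument of F, so the sum
may be averaged over both values of that argument. -/
theorem two_mul_sum_record (i : P.Measured) (F : ZMod 2 → P.Record → ℂ)
    (hF : ∀ b ω c, F b (Function.update ω i c) = F b ω) :
    2 * ∑ ω : P.Record, F (ω i) ω = ∑ ω : P.Record, ∑ b, F b ω := by
  have h : ∑ ω : P.Record, F (ω i) ω = ∑ ω : P.Record, F (ω i + 1) ω := by
    refine Fintype.sum_equiv (Equiv.addRight (Pi.single i 1)) _ _ fun ω => ?_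
    have h1 : ω + Pi.single i 1 = Function.update ω i (ω i + 1) := by
      funext j
      by_cases hj : j = i
      · subst hj; simp
      · simp [hj]
    simp only [Equiv.coe_addRight]
    rw [h1, hF, Function.update_self, add_assoc, CharTwo.add_self_eq_zero,
      add_zero]
  rw [two_mul]
  nth_rewrite 2 [h]
  rw [← Finset.sum_add_distrib]
  refine Finset.sum_congr rfl fun ω _ => ?_
  have : (Finset.univ : Finset (ZMod 2)) = {0, 1} := rfl
  rw [this, Finset.sum_pair (by decide)]
  rcases zmod_two_eq (ω i) with h | h <;> simp [h, CharTwo.add_self_eq_zero, add_comm]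

/-- The probabilities of all branches add up to one; a branch along `l` is counted once for each
assignment of outcomes to the other nodes. -/
theorem sum_trace_measureAll (A : P.AliceConverter) (B : P.OscarConverter)
    (l : List P.Measured) (hd : l.Nodup) (m : P.Record) (σ : QOp V) :
    (2 : ℂ) ^ l.length * ∑ ω : P.Record, (P.measureAll A B ω l m σ).trace =
      (2 : ℂ) ^ Fintype.card P.Measured * σ.trace := by
  induction l generalizing m σ with
  | nil =>
    simp only [measureAll, Finset.sum_const, Finset.card_univ, card_record]
    simp
  | cons i l ih =>
    rw [List.nodup_cons] at hd
    simp only [measureAll]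
    rw [List.length_cons, pow_succ, mul_assoc, P.two_mul_sum_record i (fun b ω =>
      (P.measureAll A B ω l (Function.update m i b)
        (conj (onQubit (i : V) (projPlus (P.announced A B m i + (b.val : ℝ) * Real.pi)))
          σ)).trace), Finset.sum_comm, Finset.mul_sum,
      Finset.sum_congr rfl fun b _ => ih hd.2 _ _, ← Finset.mul_sum, sum_trace_conj_projPlus]
    intro b ω c
    congr 1
    refine P.measureAll_congr A B l (fun j hj => ?_) _ _
    have hji : j ≠ i := fun h => hd.1 (h ▸ hj)
    exact Function.update_of_ne hji _ _

theorem IsSchedule.length_eq {P : Setup V} {l : List P.Measured} (hl : P.IsSchedule l) :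
    l.length = Fintype.card P.Measured := by
  rw [← List.toFinset_card_of_nodup hl.nodup, ← Finset.card_univ]
  congr 1
  ext i
  simp [hl.complete i]

theorem alice_encrypt_isometry :
    ((P.alice r t φ α).encrypt)ᴴ * (P.alice r t φ α).encrypt = 1 := by
  refine tensorOp_unitary fun i => ?_
  split_ifs with h
  · exact Matrix.mem_unitaryGroup_iff'.1 (pow_mem pauliX_unitary (t i).val)
  · exact Matrix.mem_unitaryGroup_iff'.1 (mul_mem
      (rotZ_unitary (α ⟨⟨i, h⟩, P.input_subset i.2⟩ : ℝ)) (pow_mem pauliX_unitary (t i).val))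

theorem alice_correct_isometry (ω : P.Record) :
    ((P.alice r t φ α).correct ω)ᴴ * (P.alice r t φ α).correct ω = 1 :=
  tensorOp_unitary fun _ => Matrix.mem_unitaryGroup_iff'.1 (pauli_unitary _ _)

theorem prep_isometry (S : Finset V) (γ : V → ℝ) : (prep S γ)ᴴ * prep S γ = 1 := by
  rw [prep_eq_prepKets, prepKets_conjTranspose_mul,
    Finset.prod_eq_one fun i _ => star_ketPlus_dotProduct _, one_smul]

/-- This is independent of `execute_eq`: preparation, entangling and corrections are isometric, and
the two projectors of each measurement sum to 1. -/
theorem trace_executeAll {l : List P.Measured} (hl : P.IsSchedule l) (ρ : QOp P.I) :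
    (P.executeAll (P.alice r t φ α) (P.oscar r t ψ β) l ρ).trace = ρ.trace := by
  have h : (2 : ℂ) ^ Fintype.card P.Measured ≠ 0 := pow_ne_zero _ two_ne_zero
  rw [executeAll, Matrix.trace_sum]
  simp only [execute, trace_conj_of_isometry (P.alice_correct_isometry r t φ α _), trace_traceOut]
  apply mul_left_cancel₀ h
  conv_lhs => rw [← hl.length_eq]
  rw [P.sum_trace_measureAll _ _ l hl.nodup, trace_conj_of_isometry (entangle_unitary _),
    trace_conj_of_isometry (prep_isometry _ _),
    trace_conj_of_isometry (P.alice_encrypt_isometry r t φ α)]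

theorem isometry_conjTranspose_mul_self {l : List P.Measured} (hl : P.IsSchedule l) :
    (P.isometry (P.angles φ ψ))ᴴ * P.isometry (P.angles φ ψ) = 1 := by
  -- The trace pairing is nondegenerate, so it suffices to compute tr(WρW†) in two ways. Any single
  -- choice of keys will do; zero keys with α = φ and β = ψ are at hand.
  rw [Matrix.ext_iff_trace_mul_right]
  intro ρ
  rw [one_mul, ← trace_conj, ← P.executeAll_eq 0 0 φ φ ψ ψ hl, P.trace_executeAll 0 0 φ φ ψ ψ hl]

end Setup

end BOQC

theorem mainTheorem3 {V : Type*} [Fintype V] [DecidableEq V] (P : BOQC.Setup V)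
    (φ : P.AliceNode → BOQC.Omega P.b) (ψ : P.OscarNode → BOQC.Omega P.b)
    (l : List P.Measured) (hl : P.IsSchedule l) :
    (P.isometry (P.angles φ ψ))ᴴ * P.isometry (P.angles φ ψ) = 1 ∧
    (∀ (r : P.Record) (t : P.I → ZMod 2)
        (α : P.AliceNode → BOQC.Omega P.b) (β : P.OscarNode → BOQC.Omega P.b)
        (ω : P.Record) (ρ : BOQC.QOp P.I),
      P.execute (P.alice r t φ α) (P.oscar r t ψ β) l ω ρ =
        ((2 : ℂ) ^ Fintype.card P.Measured)⁻¹ •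
          BOQC.conj (P.isometry (P.angles φ ψ)) ρ) ∧
    (∀ (r : P.Record) (t : P.I → ZMod 2)
        (α : P.AliceNode → BOQC.Omega P.b) (β : P.OscarNode → BOQC.Omega P.b)
        (ρ : BOQC.QOp P.I),
      P.executeAll (P.alice r t φ α) (P.oscar r t ψ β) l ρ =
        BOQC.conj (P.isometry (P.angles φ ψ)) ρ) ∧
    (∀ ρ : BOQC.QOp P.I,
      P.protocol φ ψ l ρ = BOQC.conj (P.isometry (P.angles φ ψ)) ρ) :=
  ⟨P.isometry_conjTranspose_mul_self φ ψ hl, fun r t α β ω ρ => P.execute_eq r t φ α ψ β hl ω ρ,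
    fun r t α β ρ => P.executeAll_eq r t φ α ψ β hl ρ, fun ρ => P.protocol_eq φ ψ hl ρ⟩
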